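/- **Setting.** Let $2\le m\le K$. A stochastic instance is a fixed matrix $P\in[0,1]^{K\times K}$ with $P(i,j)+P(j,i)=1$ and $P(i,i)=\tfrac12$. In each round $t=1,\dots,T$ a learner, possibly randomized and possibly knowing the horizon $T$, selects a multiset $\mathcal A_t$ of $m$ arms on the basis of the past selections and the past winners, and observes the winning index, which is $i\in[m]$ with probability $\sum_{j\ne i}\frac{2P(\mathcal A_t(i),\mathcal A_t(j))}{m(m-1)}$. If $a^\star$ is a Condorcet winner, i.e. $P(a^\star,i)\ge\tfrac12$ for all $i$, put $\Delta_i=P(a^\star,i)-\tfrac12$ and let $R_T^{\mathrm C}=\sum_{t=1}^T\frac1m\sum_{j=1}^m\Delta_{\mathcal A_t(j)}$ be the Condorcet pseudo-regret. An algorithm is called consistent if $\mathbb E[R_T^{\mathrm C}]=o(T^\alpha)$ as $T\to\infty$ for every $\alpha>0$ on every stochastic instance with a Condorcet winner all of whose other gaps are positive. **Theorem (stochastic lower bound).** There is a universal constant $c>0$ such that the following holds for all $2\le m\le K$. (a) Let $\delta\in\mathbb R^K$ have exactly one zero entry and all other entries in $(0,\tfrac14]$. - There is a $T_0$ such that for every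 $T\ge T_0$ and every multi-dueling bandit algorithm there is a stochastic instance with a Condorcet winner $a^\star$ whose gap vector $(\Delta_i)_i$ is a permutation of $\delta$ and on which $$\mathbb E[R_T^{\mathrm C}]\ \ge\ c\sum_{i\ne a^\star}\frac{\log T}{\Delta_i}.$$ - For every multi-dueling bandit algorithm there is a single stochastic instance with a Condorcet winner $a^\star$, whose gap vector is a permutation of $\delta$, on which this inequality holds for infinitely many $T$. (b) Let $\delta\in\mathbb R^K$ have exactly one zero entry, at the arm $a^\star$, and all other entries in $(0,\tfrac12]$. There is a stochastic instance with Condorcet winner $a^\star$ and gaps $\Delta_i=\delta_i$ for all $i$ on which every consistent multi-dueling bandit algorithm satisfies the inequality for all sufficiently large $T$. -/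

import Mathlib

open Filter Asymptotics

noncomputable section

namespace MultiDueling

/-- A preference matrix on `K` arms: `P i j` is the probability that arm `i` beats arm `j`. -/
structure PrefMatrix (K : ℕ) where
  prob : Fin K → Fin K → ℝ
  mem_Icc : ∀ i j, prob i j ∈ Set.Icc (0 : ℝ) 1
  reciprocal : ∀ i j, prob i j + prob j i = 1
  self_half : ∀ i, prob i i = 1 / 2

/-- Arm `a` is a Condorcet winner of `P`. -/
def IsCondorcetWinner {K : ℕ} (P : PrefMatrix K) (a : Fin K) : Prop :=
  ∀ i, 1 / 2 ≤ P.prob a i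

/-- The sub-optimality gap of arm `i` relative to the (Condorcet winning) arm `a`. -/
def gap {K : ℕ} (P : PrefMatrix K) (a i : Fin K) : ℝ :=
  P.prob a i - 1 / 2

/-- What the learner plays in one round: a multiset of `m` arms, listed as
`A 0, …, A (m - 1)`; repetitions are allowed. -/
abbrev Selection (K m : ℕ) : Type := Fin m → Fin K

/-- The pairwise-subset choice model: the probability that the arm at index `i` wins. -/
def winProb {K m : ℕ} (P : PrefMatrix K) (A : Selection K m) (i : Fin m) : ℝ :=
  ∑ j ∈ Finset.univ.erase i, 2 * P.prob (A i) (A j) / ((m : ℝ) * ((m : ℝ) - 1))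

theorem winProb_nonneg {K m : ℕ} (hm : 2 ≤ m) (P : PrefMatrix K) (A : Selection K m)
    (i : Fin m) : 0 ≤ winProb P A i := by
  have h2 : (2 : ℝ) ≤ m := by exact_mod_cast hm
  refine Finset.sum_nonneg fun j _ => div_nonneg ?_ (mul_nonneg ?_ ?_)
  · have := (P.mem_Icc (A i) (A j)).1
    linarith
  · linarith
  · linarith

theorem sum_winProb {K m : ℕ} (hm : 2 ≤ m) (P : PrefMatrix K) (A : Selection K m) :
    ∑ i, winProb P A i = 1 := by
  have h2 : (2 : ℝ) ≤ m := by exact_mod_cast hm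
  have hm0 : (m : ℝ) ≠ 0 := by linarith
  have hm1 : (m : ℝ) - 1 ≠ 0 := by linarith
  have herase : ∀ i, winProb P A i =
      (∑ j, 2 * P.prob (A i) (A j) - 1) / ((m : ℝ) * ((m : ℝ) - 1)) := by
    intro i
    have h := Finset.sum_erase_add (f := fun j => 2 * P.prob (A i) (A j))
      Finset.univ (Finset.mem_univ i)
    have hs := P.self_half (A i)
    simp only [winProb]
    rw [← Finset.sum_div]
    congr 1
    simp only [hs] at h
    linarith
  have hsym : ∑ i, ∑ j, 2 * P.prob (A i) (A j) = (m : ℝ) * m := by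
    have h1 : ∑ i, ∑ j, P.prob (A i) (A j) = ∑ i, ∑ j, P.prob (A j) (A i) :=
      Finset.sum_comm
    have h3 : ∑ i, ∑ j, (P.prob (A i) (A j) + P.prob (A j) (A i)) = (m : ℝ) * m := by
      simp [P.reciprocal]
    simp only [Finset.sum_add_distrib] at h3
    simp only [← Finset.mul_sum]
    linarith
  simp only [herase]
  rw [← Finset.sum_div, Finset.sum_sub_distrib, hsym, div_eq_one_iff_eq (mul_ne_zero hm0 hm1)]
  simp
  ring

/-- The law of the winning index when `A` is played against `P`. -/
def winnerLaw {K m : ℕ} (hm : 2 ≤ m) (P : PrefMatrix K) (A : Selection K m) : PMF (Fin m) :=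
  PMF.ofFintype (fun i => ENNReal.ofReal (winProb P A i)) (by
    rw [← ENNReal.ofReal_sum_of_nonneg fun i _ => winProb_nonneg hm P A i,
      sum_winProb hm P A, ENNReal.ofReal_one])

/-- The record of one round: the selection played and the winning index observed. -/
abbrev Round (K m : ℕ) : Type := Selection K m × Fin m

/-- A randomized policy: the conditional law of the next selection given all past selections
and observed winners. -/
abbrev Policy (K m : ℕ) : Type := (t : ℕ) → (Fin t → Round K m) → PMF (Selection K m)

/-- A multi-dueling bandit algorithm; it may use the horizon `T` as an input. An algorithm that
does not know the horizon is a constant function of `T`. -/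
abbrev Algorithm (K m : ℕ) : Type := ℕ → Policy K m

/-- The law of the first `t` rounds when the policy `π` plays against the stationary
preferences `P`. -/
def historyLaw {K m : ℕ} (hm : 2 ≤ m) (P : PrefMatrix K) (π : Policy K m) :
    (t : ℕ) → PMF (Fin t → Round K m)
  | 0 => PMF.pure Fin.elim0
  | t + 1 => (historyLaw hm P π t).bind fun h =>
      (π t h).bind fun A =>
        (winnerLaw hm P A).bind fun I =>
          PMF.pure (Fin.snoc (α := fun _ => Round K m) h (A, I))

/-- The cumulative Condorcet pseudo-regret along a history of `T` rounds. -/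
def condorcetRegret {K m T : ℕ} (P : PrefMatrix K) (a : Fin K) (h : Fin T → Round K m) : ℝ :=
  ∑ t, (1 / (m : ℝ)) * ∑ j, gap P a ((h t).1 j)

/-- The expected Condorcet pseudo-regret of the algorithm `alg` run with horizon `T` on the
stochastic instance `P` with Condorcet winner `a`. -/
def expectedRegret {K m : ℕ} (hm : 2 ≤ m) (P : PrefMatrix K) (a : Fin K)
    (alg : Algorithm K m) (T : ℕ) : ℝ :=
  ∑ h : Fin T → Round K m, (historyLaw hm P (alg T) T h).toReal * condorcetRegret P a h

/-- The quantity `∑_{i ≠ a} log T / Δ_i`. -/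
def logGapSum {K : ℕ} (P : PrefMatrix K) (a : Fin K) (T : ℕ) : ℝ :=
  ∑ i ∈ Finset.univ.erase a, Real.log T / gap P a i

/-- `Δ` is a vector of gaps with best arm `a`, all other gaps being positive and at most `b`. -/
def IsGapVector {K : ℕ} (Δ : Fin K → ℝ) (a : Fin K) (b : ℝ) : Prop :=
  Δ a = 0 ∧ ∀ i, i ≠ a → 0 < Δ i ∧ Δ i ≤ b

/-- Consistency: on every stochastic instance with a Condorcet winner all of whose gaps are
positive, the expected regret is `o(T ^ α)` for every `α > 0`. -/
def Consistent {K m : ℕ} (hm : 2 ≤ m) (alg : Algorithm K m) : Prop :=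
  ∀ (P : PrefMatrix K) (a : Fin K), IsCondorcetWinner P a → (∀ i, i ≠ a → 0 < gap P a i) →
    ∀ α : ℝ, 0 < α →
      (fun T : ℕ => expectedRegret hm P a alg T) =o[atTop] (fun T : ℕ => (T : ℝ) ^ α)

end MultiDueling

end

noncomputable section

namespace MultiDueling

variable {K m : ℕ}

/-! The proof is a change-of-measure argument in the style of Lai and Robbins. Take a base instance
with winner `a`, and for each other arm `i` an alternative in which only the comparisons of `i`
change, by at most `2Δ_i`, so that `i` wins. If `i` is rarely played on the base instance, the two
history laws are too close to tell apart, and the regret on the alternative is of order `√T`.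

The winner-only feedback costs no factor of `m`: one round's divergence is at most `12 d² n / m`,
with `n` the copies of `i` in the selection (`IsPromotion.sum_mul_log_le`), while those copies
contribute `Δ_i n / m` to the regret. Summed over rounds (`IsPromotion.histExp_log_le`) and combined
with Bretagnolle–Huber, this gives `IsPromotion.le_expectedRegret`: either `i` is played about `log
T / (100 Δ_i²)` times, or the alternative has polynomial regret. If every arm meets its quota, the
base regret is the required sum.

In (a) the base instance and its alternatives all have permuted gaps, so one member of a finite
family is always hard. In (b) consistency on the alternatives excludes polynomial regret. -/

/-- The number of copies of arm `i` in the selection `A`. -/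
def armCount (i : Fin K) (A : Selection K m) : ℝ := ∑ j, if A j = i then 1 else 0

theorem armCount_nonneg (i : Fin K) (A : Selection K m) : 0 ≤ armCount i A :=
  Finset.sum_nonneg fun j _ => by split_ifs <;> norm_num

theorem one_le_armCount {i : Fin K} {A : Selection K m} {l : Fin m} (h : A l = i) :
    1 ≤ armCount i A := by
  have := Finset.single_le_sum (f := fun j => if A j = i then (1 : ℝ) else 0)
    (fun j _ => by split_ifs <;> norm_num) (Finset.mem_univ l)
  exact (if_pos h).symm.le.trans this

theorem sum_erase_ite_eq_armCount {i : Fin K} {A : Selection K m} {l : Fin m} (h : A l ≠ i)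
    (x : ℝ) : ∑ j ∈ Finset.univ.erase l, (if A j = i then x else 0) = armCount i A * x := by
  have := Finset.sum_erase_add (f := fun j => if A j = i then x else 0)
      Finset.univ (Finset.mem_univ l)
  simp only [if_neg h, add_zero] at this
  simp only [this, armCount, Finset.sum_mul, ite_mul, one_mul, zero_mul]

/-- `P'` arises from `P` by changing the comparisons of arm `i` by at most `d`, in such a way
that arm `i` beats every other arm with probability between `1 / 2` and `3 / 4`. -/
structure IsPromotion (P P' : PrefMatrix K) (i : Fin K) (d : ℝ) : Prop where
  eq_off : ∀ j k, j ≠ i → k ≠ i → P'.prob j k = P.prob j k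
  abs_le : ∀ k, |P.prob i k - P'.prob i k| ≤ d
  mem : ∀ k, P'.prob i k ∈ Set.Icc (1 / 2 : ℝ) (3 / 4)

theorem IsPromotion.abs_le_col {P P' : PrefMatrix K} {i : Fin K} {d : ℝ}
    (h : IsPromotion P P' i d) (k : Fin K) : |P.prob k i - P'.prob k i| ≤ d := by
  have h1 := h.abs_le k
  have h2 := P.reciprocal i k
  have h3 := P'.reciprocal i k
  rw [show P.prob k i - P'.prob k i = -(P.prob i k - P'.prob i k) by linarith, abs_neg]
  exact h1

theorem IsPromotion.le_prob {P P' : PrefMatrix K} {i : Fin K} {d : ℝ}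
    (h : IsPromotion P P' i d) (k : Fin K) : 1 / 4 ≤ P'.prob k i := by
  have h1 := (h.mem k).2
  have h3 := P'.reciprocal i k
  linarith

/-! ### Information gained in one round. -/

section OneRound

variable {P P' : PrefMatrix K} {i : Fin K} {d : ℝ} {A : Selection K m} {l : Fin m}

/-- Each of the `m - 1` duels of a copy of `i` has weight `2 / (m (m - 1))`, shifts by at most `d`,
and is won with probability at least `1 / 2` after promotion. -/
theorem IsPromotion.winProb_of_eq (hm : 2 ≤ m) (h : IsPromotion P P' i d) (hl : A l = i) :
    |winProb P A l - winProb P' A l| ≤ 2 * d / m ∧ 1 / (m : ℝ) ≤ winProb P' A l := by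
  have h2 : (2 : ℝ) ≤ m := by exact_mod_cast hm
  have hm0 : (m : ℝ) ≠ 0 := by linarith
  have hm1 : (m : ℝ) - 1 ≠ 0 := by linarith
  have hM : 0 < (m : ℝ) * ((m : ℝ) - 1) := mul_pos (by linarith) (by linarith)
  have hcard : (((Finset.univ : Finset (Fin m)).erase l).card : ℝ) = (m : ℝ) - 1 := by
    rw [Finset.card_erase_of_mem (Finset.mem_univ l), Finset.card_univ, Fintype.card_fin,
      Nat.cast_sub (by omega)]
    simp
  constructor
  · rw [winProb, winProb, ← Finset.sum_sub_distrib]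
    calc _ ≤ ∑ j ∈ Finset.univ.erase l, 2 * d / ((m : ℝ) * ((m : ℝ) - 1)) := by
          refine (Finset.abs_sum_le_sum_abs _ _).trans (Finset.sum_le_sum fun j _ => ?_)
          rw [← sub_div, ← mul_sub, abs_div, abs_mul, abs_of_pos hM, hl]
          have := h.abs_le (A j)
          gcongr
          norm_num
      _ = 2 * d / m := by
          rw [Finset.sum_const, nsmul_eq_mul, hcard]
          field_simp
  · calc 1 / (m : ℝ)
        = ∑ j ∈ Finset.univ.erase l, 2 * (1 / 2) / ((m : ℝ) * ((m : ℝ) - 1)) := by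
          rw [Finset.sum_const, nsmul_eq_mul, hcard]
          field_simp
      _ ≤ _ := by
          refine Finset.sum_le_sum fun j _ => ?_
          have := (h.mem (A j)).1
          rw [hl]
          gcongr

/-- Only duels against copies of `i` are affected. The same duels, each won with probability at
least `1 / 4`, bound the new winning probability from below, so change and lower bound both scale
with the number of copies. -/
theorem IsPromotion.winProb_of_ne (hm : 2 ≤ m) (h : IsPromotion P P' i d) (hl : A l ≠ i) :
    |winProb P A l - winProb P' A l| ≤ armCount i A * (2 * d / ((m : ℝ) * ((m : ℝ) - 1))) ∧
      armCount i A * (1 / (2 * ((m : ℝ) * ((m : ℝ) - 1)))) ≤ winProb P' A l := by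
  have h2 : (2 : ℝ) ≤ m := by exact_mod_cast hm
  have hM : 0 < (m : ℝ) * ((m : ℝ) - 1) := mul_pos (by linarith) (by linarith)
  constructor
  · rw [winProb, winProb, ← Finset.sum_sub_distrib, ← sum_erase_ite_eq_armCount hl]
    refine (Finset.abs_sum_le_sum_abs _ _).trans (Finset.sum_le_sum fun j _ => ?_)
    rw [← sub_div, ← mul_sub, abs_div, abs_mul, abs_of_pos hM]
    split_ifs with hj
    · have := h.abs_le_col (A l)
      rw [hj]
      gcongr
      norm_num
    · simp [h.eq_off _ _ hl hj]
  · rw [winProb, ← sum_erase_ite_eq_armCount hl]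
    refine Finset.sum_le_sum fun j _ => ?_
    split_ifs with hj
    · have := h.le_prob (A l)
      rw [hj, ← div_div]
      gcongr
      linarith
    · have := (P'.mem_Icc (A l) (A j)).1
      positivity

/-- Absolute continuity is needed only from the base to the promotion, so the base may contain
probabilities `0` and `1`. -/
theorem IsPromotion.winProb_eq_zero (hm : 2 ≤ m) (h : IsPromotion P P' i d)
    (h0 : winProb P' A l = 0) : winProb P A l = 0 := by
  have h2 : (2 : ℝ) ≤ m := by exact_mod_cast hm
  have hM : 0 < (m : ℝ) * ((m : ℝ) - 1) := mul_pos (by linarith) (by linarith)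
  by_cases hl : A l = i
  · have := (h.winProb_of_eq hm hl).2
    have h3 : 0 < 1 / (m : ℝ) := by positivity
    linarith
  · obtain ⟨h3, h4⟩ := h.winProb_of_ne hm hl
    rw [h0] at h3 h4
    have h5 : 0 < 1 / (2 * ((m : ℝ) * ((m : ℝ) - 1))) := by positivity
    have h6 : armCount i A = 0 :=
      le_antisymm (nonpos_of_mul_nonpos_left h4 h5) (armCount_nonneg i A)
    simpa [h6] using h3

/-- The Kullback–Leibler divergence summand is at most the `χ²` summand plus a term that sums
to zero over probability distributions. -/
theorem mul_log_div_le {p q : ℝ} (hp : 0 ≤ p) (hq : 0 ≤ q) (hpq : q = 0 → p = 0) :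
    p * Real.log (p / q) ≤ (p - q) ^ 2 / q + (p - q) := by
  rcases hq.eq_or_lt with rfl | hq
  · simp [hpq rfl]
  rcases hp.eq_or_lt with rfl | hp
  · have : (0 - q) ^ 2 / q = q := by field_simp; ring
    rw [this]
    simp
  · calc p * Real.log (p / q) ≤ p * (p / q - 1) := by
          gcongr
          exact Real.log_le_sub_one_of_pos (by positivity)
      _ = _ := by field_simp; ring

/-- KL is bounded by `χ²`: the `n` copies of `i` give `4 d² n / m` in total, the remaining indices
at most `8 d² n / m`. -/
theorem IsPromotion.sum_mul_log_le (hm : 2 ≤ m) (h : IsPromotion P P' i d)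
    (A : Selection K m) :
    ∑ l, winProb P A l * Real.log (winProb P A l / winProb P' A l) ≤
      12 * d ^ 2 * (armCount i A / m) := by
  have h2 : (2 : ℝ) ≤ m := by exact_mod_cast hm
  have hm1 : 0 < (m : ℝ) - 1 := by linarith
  have hm0 : 0 < (m : ℝ) := by linarith
  set n := armCount i A with hn
  have hn0 : 0 ≤ n := armCount_nonneg i A
  have hchi : ∀ l, (winProb P A l - winProb P' A l) ^ 2 / winProb P' A l ≤
      (if A l = i then 1 else 0) * (4 * d ^ 2 / m) +
        (1 - if A l = i then 1 else 0) * (8 * d ^ 2 * n / ((m : ℝ) * ((m : ℝ) - 1))) := by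
    intro l
    split_ifs with hl
    · obtain ⟨h3, h4⟩ := h.winProb_of_eq hm hl
      have h5 : (winProb P A l - winProb P' A l) ^ 2 ≤ (2 * d / m) ^ 2 := by
        rw [← sq_abs]
        gcongr
      calc _ ≤ (2 * d / m) ^ 2 / (1 / (m : ℝ)) := by gcongr
        _ = _ := by field_simp; ring
    · obtain ⟨h3, h4⟩ := h.winProb_of_ne hm hl
      rw [← hn] at h3 h4
      -- Without copies of `i` the lower bound on `winProb P' A l` is void, but the two laws agree.
      rcases hn0.eq_or_lt with h0 | hpos
      · rw [← h0] at h3 ⊢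
        have h6 : winProb P A l - winProb P' A l = 0 := by simpa using h3
        simp [h6]
      have h5 : (winProb P A l - winProb P' A l) ^ 2 ≤
          (n * (2 * d / ((m : ℝ) * ((m : ℝ) - 1)))) ^ 2 := by
        rw [← sq_abs]
        gcongr
      calc _ ≤ (n * (2 * d / ((m : ℝ) * ((m : ℝ) - 1)))) ^ 2 /
            (n * (1 / (2 * ((m : ℝ) * ((m : ℝ) - 1))))) := by gcongr
        _ = _ := by field_simp; ring
  calc _ ≤ ∑ l, ((winProb P A l - winProb P' A l) ^ 2 / winProb P' A l +
        (winProb P A l - winProb P' A l)) :=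
        Finset.sum_le_sum fun l _ => mul_log_div_le (winProb_nonneg hm P A l)
          (winProb_nonneg hm P' A l) (h.winProb_eq_zero hm)
    _ = ∑ l, (winProb P A l - winProb P' A l) ^ 2 / winProb P' A l := by
        rw [Finset.sum_add_distrib, Finset.sum_sub_distrib, sum_winProb hm, sum_winProb hm]
        ring
    _ ≤ _ := Finset.sum_le_sum fun l _ => hchi l
    _ = n * (4 * d ^ 2 / m) +
        (m - n) * (8 * d ^ 2 * n / ((m : ℝ) * ((m : ℝ) - 1))) := by
        rw [Finset.sum_add_distrib, ← Finset.sum_mul, ← Finset.sum_mul,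
          Finset.sum_sub_distrib]
        simp [hn, armCount]
    _ ≤ n * (4 * d ^ 2 / m) + 8 * d ^ 2 * n / m := by
        gcongr
        -- If `i` occurs at all then `m - n ≤ m - 1`, which cancels the factor `m - 1` in the
        -- denominator.
        by_cases he : ∃ l, A l = i
        · obtain ⟨l, hl⟩ := he
          have h1 : 1 ≤ n := one_le_armCount hl
          calc _ ≤ ((m : ℝ) - 1) * (8 * d ^ 2 * n / ((m : ℝ) * ((m : ℝ) - 1))) := by gcongr
            _ = _ := by field_simp
        · have h1 : n = 0 := by
            push Not at he
            simp [hn, armCount, he]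
          simp [h1]
    _ = _ := by ring

end OneRound

/-! ### Laws of histories and their recursion. -/

/-- The real-valued probability of a history. -/
def histProb (hm : 2 ≤ m) (P : PrefMatrix K) (π : Policy K m) (t : ℕ)
    (h : Fin t → Round K m) : ℝ :=
  (historyLaw hm P π t h).toReal

/-- The expectation of a function of the first `t` rounds. -/
def histExp (hm : 2 ≤ m) (P : PrefMatrix K) (π : Policy K m) (t : ℕ)
    (F : (Fin t → Round K m) → ℝ) : ℝ :=
  ∑ h, histProb hm P π t h * F h

/-- The average number of copies of arm `i` per selection, accumulated along a history. -/
def playCount {T : ℕ} (i : Fin K) (h : Fin T → Round K m) : ℝ :=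
  ∑ t, armCount i (h t).1 / m

theorem histProb_nonneg (hm : 2 ≤ m) (P : PrefMatrix K) (π : Policy K m) (t : ℕ)
    (h : Fin t → Round K m) : 0 ≤ histProb hm P π t h :=
  ENNReal.toReal_nonneg

theorem sum_toReal_eq_one {α : Type*} [Fintype α] (p : PMF α) : ∑ x, (p x).toReal = 1 := by
  rw [← ENNReal.toReal_sum fun x _ => p.apply_ne_top x, ← tsum_fintype (L := .unconditional _),
    p.tsum_coe, ENNReal.toReal_one]

theorem sum_histProb (hm : 2 ≤ m) (P : PrefMatrix K) (π : Policy K m) (t : ℕ) :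
    ∑ h, histProb hm P π t h = 1 :=
  sum_toReal_eq_one _

theorem toReal_winnerLaw (hm : 2 ≤ m) (P : PrefMatrix K) (A : Selection K m) (I : Fin m) :
    (winnerLaw hm P A I).toReal = winProb P A I := by
  simp [winnerLaw, winProb_nonneg hm P A I]

theorem histProb_snoc (hm : 2 ≤ m) (P : PrefMatrix K) (π : Policy K m) (t : ℕ)
    (h : Fin t → Round K m) (A : Selection K m) (I : Fin m) :
    histProb hm P π (t + 1) (Fin.snoc (α := fun _ => Round K m) h (A, I)) =
      histProb hm P π t h * ((π t h A).toReal * winProb P A I) := by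
  have key : historyLaw hm P π (t + 1) (Fin.snoc (α := fun _ => Round K m) h (A, I)) =
      historyLaw hm P π t h * (π t h A * winnerLaw hm P A I) := by
    rw [historyLaw, PMF.bind_apply, tsum_eq_single h, PMF.bind_apply, tsum_eq_single A,
      PMF.bind_apply, tsum_eq_single I]
    · simp
    · intro I' hI
      simp [Fin.snoc_inj, hI.symm]
    · intro A' hA
      simp [Fin.snoc_inj, hA.symm]
    · intro h' hh
      simp [Fin.snoc_inj, hh.symm]
  rw [histProb, key, ENNReal.toReal_mul, ENNReal.toReal_mul, toReal_winnerLaw, histProb]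

theorem sum_snoc {t : ℕ} (F : (Fin (t + 1) → Round K m) → ℝ) :
    ∑ h, F h = ∑ h : Fin t → Round K m, ∑ A : Selection K m, ∑ I : Fin m,
      F (Fin.snoc (α := fun _ => Round K m) h (A, I)) := by
  rw [← (Fin.snocEquiv fun _ : Fin (t + 1) => Round K m).sum_comp, Fintype.sum_prod_type_right]
  refine Finset.sum_congr rfl fun h _ => ?_
  rw [Fintype.sum_prod_type]
  rfl

/-- Splitting off the last round of the expectation of a sum. -/
theorem sum_histProb_mul_add (hm : 2 ≤ m) (P : PrefMatrix K) (π : Policy K m) (t : ℕ)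
    (F : (Fin t → Round K m) → ℝ) (g : Selection K m → Fin m → ℝ) :
    ∑ h, ∑ A, ∑ I, histProb hm P π t h * ((π t h A).toReal * winProb P A I) * (F h + g A I) =
      histExp hm P π t F +
        ∑ h, histProb hm P π t h * ∑ A, (π t h A).toReal * ∑ I, winProb P A I * g A I := by
  rw [histExp, ← Finset.sum_add_distrib]
  refine Finset.sum_congr rfl fun h _ => ?_
  rw [← mul_add]
  have h1 : F h = ∑ A, (π t h A).toReal * ∑ I, winProb P A I * F h := by
    simp only [← Finset.sum_mul, sum_winProb hm, sum_toReal_eq_one, one_mul]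
  conv_rhs => rw [h1]
  rw [← Finset.sum_add_distrib]
  simp only [← mul_add, ← Finset.sum_add_distrib, Finset.mul_sum]
  refine Finset.sum_congr rfl fun A _ => Finset.sum_congr rfl fun I _ => ?_
  ring

theorem playCount_snoc {t : ℕ} (i : Fin K) (h : Fin t → Round K m) (r : Round K m) :
    playCount i (Fin.snoc (α := fun _ => Round K m) h r) =
      playCount i h + armCount i r.1 / m := by
  simp [playCount, Fin.sum_univ_castSucc]

theorem histExp_playCount_succ (hm : 2 ≤ m) (P : PrefMatrix K) (π : Policy K m) (t : ℕ)
    (i : Fin K) :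
    histExp hm P π (t + 1) (playCount i) = histExp hm P π t (playCount i) +
      ∑ h, histProb hm P π t h * ∑ A, (π t h A).toReal * (armCount i A / m) := by
  have h1 := sum_histProb_mul_add hm P π t (playCount i) fun A _ => armCount i A / m
  simp only [← Finset.sum_mul, sum_winProb hm, one_mul] at h1
  rw [← h1, histExp, sum_snoc]
  simp only [histProb_snoc, playCount_snoc, Finset.sum_mul]

/-! ### Divergence of history laws. -/

section Divergence

variable {P P' : PrefMatrix K} {i : Fin K} {d : ℝ}

theorem IsPromotion.histProb_eq_zero (hm : 2 ≤ m) (hP : IsPromotion P P' i d)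
    (π : Policy K m) (t : ℕ) (h : Fin t → Round K m) (h0 : histProb hm P' π t h = 0) :
    histProb hm P π t h = 0 := by
  induction t with
  | zero => exact h0
  | succ t ih =>
    obtain ⟨⟨⟨A, I⟩, h⟩, rfl⟩ := (Fin.snocEquiv fun _ : Fin (t + 1) => Round K m).surjective h
    change histProb hm P π (t + 1) (Fin.snoc (α := fun _ => Round K m) h (A, I)) = 0
    change histProb hm P' π (t + 1) (Fin.snoc (α := fun _ => Round K m) h (A, I)) = 0 at h0
    rw [histProb_snoc] at h0 ⊢
    rcases mul_eq_zero.1 h0 with h1 | h1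
    · rw [ih _ h1, zero_mul]
    rcases mul_eq_zero.1 h1 with h2 | h2
    · rw [h2, zero_mul, mul_zero]
    · rw [hP.winProb_eq_zero hm h2, mul_zero, mul_zero]

/-- The Kullback–Leibler divergence of the laws of the history under a base instance and under
a promotion of arm `i` is controlled by the expected number of plays of arm `i`. -/
theorem IsPromotion.histExp_log_le (hm : 2 ≤ m) (hP : IsPromotion P P' i d)
    (π : Policy K m) (t : ℕ) :
    histExp hm P π t (fun h => Real.log (histProb hm P π t h / histProb hm P' π t h)) ≤
      12 * d ^ 2 * histExp hm P π t (playCount i) := by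
  induction t with
  | zero => simp [histExp, histProb, historyLaw, playCount, Subsingleton.elim _ Fin.elim0]
  | succ t ih =>
    rw [histExp_playCount_succ, mul_add]
    refine le_trans (b := _ + ∑ h, histProb hm P π t h * ∑ A, (π t h A).toReal *
      ∑ I, winProb P A I * Real.log (winProb P A I / winProb P' A I))
      (le_of_eq ?_) (add_le_add ih ?_)
    · rw [← sum_histProb_mul_add, histExp, sum_snoc]
      refine Finset.sum_congr rfl fun h _ => Finset.sum_congr rfl fun A _ =>
        Finset.sum_congr rfl fun I _ => ?_
      rw [histProb_snoc, histProb_snoc]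
      -- Null factors kill both sides. Otherwise absolute continuity lets the logarithm split, and
      -- the policy's factor, common to both laws, cancels.
      by_cases h1 : histProb hm P π t h = 0
      · simp [h1]
      by_cases h2 : (π t h A).toReal = 0
      · simp [h2]
      by_cases h3 : winProb P A I = 0
      · simp [h3]
      have h1' := mt (hP.histProb_eq_zero hm π t h) h1
      have h3' := mt (hP.winProb_eq_zero hm) h3
      rw [← Real.log_mul (div_ne_zero h1 h1') (div_ne_zero h3 h3')]
      congr 2
      field_simp
    · rw [Finset.mul_sum]
      refine Finset.sum_le_sum fun h _ => ?_
      rw [mul_left_comm]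
      refine mul_le_mul_of_nonneg_left ?_ (histProb_nonneg _ _ _ _ _)
      rw [Finset.mul_sum]
      refine Finset.sum_le_sum fun A _ => ?_
      rw [mul_left_comm]
      exact mul_le_mul_of_nonneg_left (hP.sum_mul_log_le hm A) ENNReal.toReal_nonneg

end Divergence

/-! ### Testing inequality and regret on a promoted instance. -/

/-- The Bretagnolle–Huber inequality on a finite type. -/
theorem bretagnolle_huber {α : Type*} [Fintype α] {p q : α → ℝ} (hp : ∀ x, 0 ≤ p x)
    (hq : ∀ x, 0 ≤ q x) (hp1 : ∑ x, p x = 1) (hq1 : ∑ x, q x = 1)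
    (hpq : ∀ x, q x = 0 → p x = 0) (E : α → Prop) [DecidablePred E] :
    Real.exp (-∑ x, p x * Real.log (p x / q x)) ≤
      2 * (∑ x, (if E x then p x else 0) + ∑ x, if E x then 0 else q x) := by
  set D := ∑ x, p x * Real.log (p x / q x) with hD
  set a := ∑ x, (if E x then p x else 0)
  set b := ∑ x, if E x then 0 else q x
  set B := ∑ x, √(p x * q x)
  -- Jensen's inequality for the Bhattacharyya coefficient `B`, proved by the tangent line of `exp`
  -- at `-D / 2`; the linear terms cancel on summing.
  have hBD : Real.exp (-(D / 2)) ≤ B := by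
    have h1 : ∀ x, Real.exp (-(D / 2)) *
        (p x + (-(1 / 2) * (p x * Real.log (p x / q x)) + p x * (D / 2))) ≤ √(p x * q x) := by
      intro x
      rcases (hp x).eq_or_lt with h0 | h0
      · simp [← h0]
      have hq0 : 0 < q x := (hq x).lt_of_ne fun h => h0.ne' (hpq x h.symm)
      have h2 : √(p x * q x) = p x * Real.exp (-(1 / 2) * Real.log (p x / q x)) := by
        rw [mul_comm (-(1 / 2) : ℝ), ← Real.rpow_def_of_pos (div_pos h0 hq0), Real.rpow_neg
          (div_pos h0 hq0).le, ← Real.sqrt_eq_rpow, Real.sqrt_eq_iff_mul_self_eq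
          (by positivity) (by positivity)]
        have := Real.sq_sqrt (div_pos h0 hq0).le
        field_simp
        rw [this]
        field_simp
      rw [h2, show -(1 / 2) * Real.log (p x / q x) =
        -(D / 2) + (-(1 / 2) * Real.log (p x / q x) + D / 2) by ring, Real.exp_add]
      have h3 := Real.add_one_le_exp (-(1 / 2) * Real.log (p x / q x) + D / 2)
      calc _ = p x * (Real.exp (-(D / 2)) *
            (-(1 / 2) * Real.log (p x / q x) + D / 2 + 1)) := by ring
        _ ≤ _ := by gcongr
    have h2 := Finset.sum_le_sum fun x (_ : x ∈ Finset.univ) => h1 x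
    rw [← Finset.mul_sum, Finset.sum_add_distrib, Finset.sum_add_distrib, ← Finset.mul_sum,
      ← Finset.sum_mul, hp1, ← hD] at h2
    calc _ = Real.exp (-(D / 2)) * (1 + (-(1 / 2) * D + 1 * (D / 2))) := by ring
      _ ≤ B := h2
  -- Cauchy–Schwarz with `p q = min · max`: the minimum is at most `p` on `E` and `q` off `E`, and
  -- the maximum is at most `p + q`.
  have hB : B ^ 2 ≤ 2 * (a + b) := by
    have h1 : B = ∑ x, √(min (p x) (q x)) * √(max (p x) (q x)) := by
      refine Finset.sum_congr rfl fun x _ => ?_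
      rw [← Real.sqrt_mul (le_min (hp x) (hq x)), min_mul_max]
    have h2 := Finset.sum_mul_sq_le_sq_mul_sq Finset.univ
      (fun x => √(min (p x) (q x))) (fun x => √(max (p x) (q x)))
    rw [← h1] at h2
    have h3 : ∑ x, √(min (p x) (q x)) ^ 2 ≤ a + b := by
      rw [← Finset.sum_add_distrib]
      refine Finset.sum_le_sum fun x _ => ?_
      rw [Real.sq_sqrt (le_min (hp x) (hq x))]
      split_ifs <;> simp
    have h4 : ∑ x, √(max (p x) (q x)) ^ 2 ≤ 2 := by
      calc _ ≤ ∑ x, (p x + q x) := by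
            refine Finset.sum_le_sum fun x _ => ?_
            rw [Real.sq_sqrt ((hp x).trans (le_max_left _ _))]
            exact max_le (by linarith [hq x]) (by linarith [hp x])
        _ = 2 := by rw [Finset.sum_add_distrib, hp1, hq1]; norm_num
    have h5 : 0 ≤ ∑ x, √(max (p x) (q x)) ^ 2 := Finset.sum_nonneg fun x _ => sq_nonneg _
    have h6 : 0 ≤ ∑ x, √(min (p x) (q x)) ^ 2 := Finset.sum_nonneg fun x _ => sq_nonneg _
    nlinarith
  calc Real.exp (-D) = Real.exp (-(D / 2)) ^ 2 := by
        rw [← Real.exp_nat_mul]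
        congr 1
        push_cast
        ring
    _ ≤ B ^ 2 := by gcongr
    _ ≤ _ := hB

theorem playCount_nonneg {T : ℕ} (i : Fin K) (h : Fin T → Round K m) : 0 ≤ playCount i h :=
  Finset.sum_nonneg fun _ _ => div_nonneg (armCount_nonneg _ _) (Nat.cast_nonneg m)

theorem condorcetRegret_eq {T : ℕ} (P : PrefMatrix K) (a : Fin K) (h : Fin T → Round K m) :
    condorcetRegret P a h = ∑ i, gap P a i * playCount i h := by
  have key : ∀ A : Selection K m,
      1 / (m : ℝ) * ∑ j, gap P a (A j) = ∑ i, gap P a i * (armCount i A / m) := by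
    intro A
    simp only [armCount, Finset.sum_div, Finset.mul_sum]
    rw [Finset.sum_comm (γ := Fin K)]
    refine Finset.sum_congr rfl fun j _ => ?_
    rw [Finset.sum_eq_single (A j)]
    · rw [if_pos rfl]
      ring
    · intro i _ hi
      simp [hi.symm]
    · simp
  simp only [condorcetRegret, playCount, Finset.mul_sum (s := Finset.univ (α := Fin T)), key]
  exact Finset.sum_comm

theorem sum_playCount (hm : 2 ≤ m) {T : ℕ} (h : Fin T → Round K m) :
    ∑ i, playCount i h = T := by
  have hm0 : (m : ℝ) ≠ 0 := by
    have : m ≠ 0 := by omega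
    exact_mod_cast this
  simp only [playCount]
  rw [Finset.sum_comm]
  have h1 : ∀ A : Selection K m, ∑ i, armCount i A / m = 1 := by
    intro A
    rw [← Finset.sum_div, div_eq_one_iff_eq hm0]
    simp only [armCount]
    rw [Finset.sum_comm]
    simp
  simp [h1]

theorem gap_self (P : PrefMatrix K) (a : Fin K) : gap P a a = 0 := by
  simp [gap, P.self_half]

theorem expectedRegret_eq (hm : 2 ≤ m) (P : PrefMatrix K) (a : Fin K) (alg : Algorithm K m)
    (T : ℕ) :
    expectedRegret hm P a alg T =
      ∑ i, gap P a i * histExp hm P (alg T) T (playCount i) := by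
  simp only [expectedRegret, condorcetRegret_eq, histExp, Finset.mul_sum]
  rw [Finset.sum_comm]
  refine Finset.sum_congr rfl fun i _ => Finset.sum_congr rfl fun h _ => ?_
  rw [histProb]
  ring

theorem mul_sub_playCount_le_condorcetRegret (hm : 2 ≤ m) {P : PrefMatrix K} {a : Fin K} {g : ℝ}
    (hg : ∀ k, k ≠ a → g ≤ gap P a k) {T : ℕ} (h : Fin T → Round K m) :
    g * (T - playCount a h) ≤ condorcetRegret P a h := by
  rw [condorcetRegret_eq, ← sum_playCount hm h,
    ← Finset.sum_erase_add _ _ (Finset.mem_univ a), add_sub_cancel_right, Finset.mul_sum,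
    ← Finset.sum_erase_add _ _ (Finset.mem_univ a), gap_self, zero_mul, add_zero]
  refine Finset.sum_le_sum fun k hk => ?_
  exact mul_le_mul_of_nonneg_right (hg k (Finset.ne_of_mem_erase hk)) (playCount_nonneg k h)

/-- An algorithm that plays arm `i` rarely on the base instance has large regret on the
instance in which `i` is promoted to be the Condorcet winner. -/
theorem IsPromotion.le_expectedRegret (hm : 2 ≤ m) {P P' : PrefMatrix K} {i : Fin K} {δ g : ℝ}
    (hP : IsPromotion P P' i (2 * δ)) (hδ : 0 < δ) (hg0 : 0 ≤ g)
    (hg : ∀ k, k ≠ i → g ≤ gap P' i k) (alg : Algorithm K m) {T : ℕ} (hT : 0 < T)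
    (hN : histExp hm P (alg T) T (playCount i) ≤ Real.log T / (100 * δ ^ 2)) :
    g * (√T / 4 - Real.log T / (100 * δ ^ 2)) ≤ expectedRegret hm P' i alg T := by
  classical
  have hT0 : (0 : ℝ) < T := by exact_mod_cast hT
  have hlog : 0 ≤ Real.log T := Real.log_natCast_nonneg T
  set p := histProb hm P (alg T) T
  set q := histProb hm P' (alg T) T
  have hp : ∀ h, 0 ≤ p h := histProb_nonneg hm P _ _
  have hq : ∀ h, 0 ≤ q h := histProb_nonneg hm P' _ _
  set N : (Fin T → Round K m) → ℝ := playCount i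
  have hBH := bretagnolle_huber hp hq (sum_histProb hm P _ _) (sum_histProb hm P' _ _)
    (hP.histProb_eq_zero hm _ _) fun h => (T : ℝ) / 2 < N h
  set a := ∑ h, (if (T : ℝ) / 2 < N h then p h else 0)
  set b := ∑ h, (if (T : ℝ) / 2 < N h then 0 else q h)
  -- The constant `100` makes `12 · 4 / 100 = 12 / 25` at most `1 / 2`, so the divergence costs at
  -- most a factor `1 / √T`.
  have hKL : ∑ h, p h * Real.log (p h / q h) ≤ 1 / 2 * Real.log T := by
    calc _ ≤ 12 * (2 * δ) ^ 2 * histExp hm P (alg T) T (playCount i) :=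
          hP.histExp_log_le hm (alg T) T
      _ ≤ 12 * (2 * δ) ^ 2 * (Real.log T / (100 * δ ^ 2)) := by gcongr
      _ = 12 / 25 * Real.log T := by field_simp; ring
      _ ≤ _ := by linarith
  have hexp : 1 / √T ≤ 2 * (a + b) := by
    refine le_trans ?_ hBH
    rw [Real.sqrt_eq_rpow, Real.rpow_def_of_pos hT0, one_div, ← Real.exp_neg]
    gcongr
    linarith
  -- Markov's inequality on the base instance.
  have ha : T / 2 * a ≤ Real.log T / (100 * δ ^ 2) := by
    refine le_trans ?_ hN
    rw [histExp, Finset.mul_sum]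
    refine Finset.sum_le_sum fun h _ => ?_
    split_ifs with hE
    · rw [mul_comm]
      exact mul_le_mul_of_nonneg_left hE.le (hp h)
    · rw [mul_zero]
      exact mul_nonneg (hp h) (playCount_nonneg i h)
  -- Off the event, arms other than `i` receive at least half of all plays, each costing at least
  -- `g`.
  have hb : g * (T / 2 * b) ≤ expectedRegret hm P' i alg T := by
    rw [expectedRegret, Finset.mul_sum, Finset.mul_sum]
    refine Finset.sum_le_sum fun h _ => ?_
    have h1 := mul_sub_playCount_le_condorcetRegret hm hg h
    change _ ≤ q h * _
    refine le_trans ?_ (mul_le_mul_of_nonneg_left h1 (hq h))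
    have h3 : playCount i h ≤ T := by
      rw [← sum_playCount hm h]
      exact Finset.single_le_sum (fun k _ => playCount_nonneg k h) (Finset.mem_univ i)
    split_ifs with hE
    · rw [mul_zero, mul_zero]
      exact mul_nonneg (hq h) (mul_nonneg hg0 (by linarith))
    · have h2 : (T : ℝ) / 2 ≤ T - playCount i h := by
        have : playCount i h ≤ T / 2 := not_lt.1 hE
        linarith
      calc g * (T / 2 * q h) = q h * (g * (T / 2)) := by ring
        _ ≤ _ := by gcongr; exact hq h
  refine le_trans (mul_le_mul_of_nonneg_left ?_ hg0) hb
  have h1 : √T / 4 = T / 4 * (1 / √T) := by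
    have := Real.mul_self_sqrt hT0.le
    have hs : 0 < √(T : ℝ) := Real.sqrt_pos.2 hT0
    field_simp
    linarith
  have h2 : T / 4 * (1 / √(T : ℝ)) ≤ T / 4 * (2 * (a + b)) := by gcongr
  linarith

theorem eventually_log_add_rpow_le (A B : ℝ) {g : ℝ} (hg : 0 < g) (C : ℝ) :
    ∀ᶠ T : ℕ in atTop,
      A * Real.log T + B * (T : ℝ) ^ (1 / 4 : ℝ) < g * (√T / 4 - Real.log T / C) := by
  have h1 : (fun x : ℝ => (A + g / C) * Real.log x + B * x ^ (1 / 4 : ℝ)) =o[atTop]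
      fun x : ℝ => x ^ (1 / 2 : ℝ) := by
    refine ((isLittleO_log_rpow_atTop (by norm_num)).const_mul_left _).add
      (IsLittleO.const_mul_left ?_ _)
    refine isLittleO_of_tendsto' ?_ ?_
    · filter_upwards [eventually_gt_atTop 0] with x hx h0
      exact absurd h0 (Real.rpow_pos_of_pos hx _).ne'
    · refine (tendsto_rpow_neg_atTop (y := 1 / 4) (by norm_num)).congr' ?_
      filter_upwards [eventually_gt_atTop 0] with x hx
      rw [← Real.rpow_sub hx]
      norm_num
  -- Any constant below `g / 4` would do; the term `g log T / C` is already absorbed in `h1`.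
  have h2 := (h1.comp_tendsto tendsto_natCast_atTop_atTop).def (show 0 < g / 8 by positivity)
  filter_upwards [h2, eventually_gt_atTop 0] with T hT hpos
  have hs : 0 < √(T : ℝ) := Real.sqrt_pos.2 (by exact_mod_cast hpos)
  simp only [Function.comp, ← Real.sqrt_eq_rpow, Real.norm_eq_abs, abs_of_pos hs] at hT
  have h3 := (le_abs_self _).trans hT
  have h4 : g * (Real.log T / C) = g / C * Real.log T := by ring
  have h5 : 0 < g * √(T : ℝ) := mul_pos hg hs
  rw [mul_sub, h4]
  linarith

/-- If every arm is played often, the regret is large. -/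
theorem logGapSum_le_expectedRegret (hm : 2 ≤ m) {P : PrefMatrix K} {a : Fin K}
    (hgap : ∀ i, i ≠ a → 0 < gap P a i) (alg : Algorithm K m) (T : ℕ)
    (hN : ∀ i, i ≠ a →
      Real.log T / (100 * gap P a i ^ 2) ≤ histExp hm P (alg T) T (playCount i)) :
    1 / 100 * logGapSum P a T ≤ expectedRegret hm P a alg T := by
  rw [expectedRegret_eq, ← Finset.sum_erase_add _ _ (Finset.mem_univ a), gap_self, zero_mul,
    add_zero, logGapSum, Finset.mul_sum]
  refine Finset.sum_le_sum fun i hi => ?_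
  have hi' := Finset.ne_of_mem_erase hi
  have h0 := hgap i hi'
  calc _ = gap P a i * (Real.log T / (100 * gap P a i ^ 2)) := by field_simp
    _ ≤ _ := by gcongr; exact hN i hi'

/-! ### Construction of the hard instances. -/

theorem PrefMatrix.ext_prob {P Q : PrefMatrix K} (h : ∀ j k, P.prob j k = Q.prob j k) :
    P = Q := by
  cases P
  cases Q
  congr
  funext j k
  exact h j k

/-- The preference matrix with a given skew-symmetric matrix of margins. -/
def PrefMatrix.ofMargin (f : Fin K → Fin K → ℝ) (hskew : ∀ i j, f i j + f j i = 0)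
    (hle : ∀ i j, f i j ≤ 1 / 2) : PrefMatrix K where
  prob i j := 1 / 2 + f i j
  mem_Icc i j := ⟨by linarith [hskew i j, hle j i], by linarith [hle i j]⟩
  reciprocal i j := by linarith [hskew i j]
  self_half i := by linarith [hskew i i]

/-- Replace the margins of arm `i` by `r`. -/
def PrefMatrix.updateArm (P : PrefMatrix K) (i : Fin K) (r : Fin K → ℝ) (hri : r i = 0)
    (hr : ∀ k, |r k| ≤ 1 / 2) : PrefMatrix K where
  prob j k := if j = i then 1 / 2 + r k else if k = i then 1 / 2 - r j else P.prob j k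
  mem_Icc j k := by
    have h1 := abs_le.1 (hr j)
    have h2 := abs_le.1 (hr k)
    split_ifs
    · constructor <;> linarith
    · constructor <;> linarith
    · exact P.mem_Icc j k
  reciprocal j k := by
    by_cases hj : j = i <;> by_cases hk : k = i
    · simp only [hj, hk, if_true, hri]; norm_num
    · simp only [hj, hk, if_true, if_false]; ring
    · simp only [hj, hk, if_true, if_false]; ring
    · simp only [hj, hk, if_false, P.reciprocal]
  self_half j := by
    split_ifs with hj
    · simp [hj, hri]
    · exact P.self_half j

theorem gap_updateArm (P : PrefMatrix K) (i : Fin K) (r : Fin K → ℝ) (hri : r i = 0)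
    (hr : ∀ k, |r k| ≤ 1 / 2) (k : Fin K) : gap (P.updateArm i r hri hr) i k = r k := by
  simp [gap, PrefMatrix.updateArm]

theorem isPromotion_updateArm (P : PrefMatrix K) (i : Fin K) (r : Fin K → ℝ) (hri : r i = 0)
    (hr : ∀ k, |r k| ≤ 1 / 2) (hr' : ∀ k, 0 ≤ r k ∧ r k ≤ 1 / 4) {d : ℝ}
    (hd : ∀ k, |P.prob i k - (1 / 2 + r k)| ≤ d) :
    IsPromotion P (P.updateArm i r hri hr) i d where
  eq_off j k hj hk := by simp [PrefMatrix.updateArm, hj, hk]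
  abs_le k := by simpa [PrefMatrix.updateArm] using hd k
  mem k := by
    simp only [PrefMatrix.updateArm, if_true]
    constructor <;> linarith [hr' k]

theorem IsGapVector.nonneg {Δ : Fin K → ℝ} {a : Fin K} {b : ℝ} (h : IsGapVector Δ a b)
    (i : Fin K) : 0 ≤ Δ i := by
  by_cases hi : i = a
  · rw [hi, h.1]
  · exact (h.2 i hi).1.le

theorem IsGapVector.le {Δ : Fin K → ℝ} {a : Fin K} {b : ℝ} (h : IsGapVector Δ a b) (hb : 0 ≤ b)
    (i : Fin K) : Δ i ≤ b := by
  by_cases hi : i = a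
  · rwa [hi, h.1]
  · exact (h.2 i hi).2

theorem IsGapVector.exists_pos_le {Δ : Fin K → ℝ} {a : Fin K} {b : ℝ}
    (h : IsGapVector Δ a b) : ∃ g, 0 < g ∧ ∀ i, i ≠ a → g ≤ Δ i := by
  rcases (Finset.univ.erase a).eq_empty_or_nonempty with he | he
  · exact ⟨1, one_pos, fun i hi => absurd (Finset.mem_erase.2 ⟨hi, Finset.mem_univ i⟩)
      (by simp [he])⟩
  · obtain ⟨j, hj, hmin⟩ := Finset.exists_min_image _ Δ he
    exact ⟨Δ j, (h.2 j (Finset.ne_of_mem_erase hj)).1,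
      fun i hi => hmin i (Finset.mem_erase.2 ⟨hi, Finset.mem_univ i⟩)⟩

theorem logGapSum_eq_of_perm {P : PrefMatrix K} {a a₀ : Fin K} {Δ : Fin K → ℝ}
    (σ : Equiv.Perm (Fin K)) (h : ∀ i, gap P a i = Δ (σ i)) (ha : σ a = a₀) (T : ℕ) :
    logGapSum P a T = Real.log T * ∑ i ∈ Finset.univ.erase a₀, 1 / Δ i := by
  rw [logGapSum, Finset.mul_sum]
  refine Finset.sum_equiv σ (fun i => ?_) fun i _ => ?_
  · simp [← ha]
  · rw [h, mul_one_div]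

/-- Finitely many instances, indexed by their Condorcet winner, one of which is hard for any
given algorithm at any large horizon. -/
theorem exists_hard_family (hm : 2 ≤ m) {Δ : Fin K → ℝ} {a₀ : Fin K}
    (hΔ : IsGapVector Δ a₀ (1 / 4)) :
    ∃ Q : Fin K → PrefMatrix K,
      (∀ a, IsCondorcetWinner (Q a) a ∧ ∃ σ : Equiv.Perm (Fin K), ∀ i, gap (Q a) a i = Δ (σ i)) ∧
      ∀ᶠ T : ℕ in atTop, ∀ alg : Algorithm K m,
        ∃ a, 1 / 100 * logGapSum (Q a) a T ≤ expectedRegret hm (Q a) a alg T := by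
  have hn := hΔ.nonneg
  have hle := hΔ.le (by norm_num)
  obtain ⟨g, hg0, hg⟩ := hΔ.exists_pos_le
  -- With margins `Δ k - Δ j`, giving row `i` the gaps permuted by `swap a₀ i` shifts its entries by
  -- at most `2 Δ i`, the extreme being at `a₀`, where `-Δ i` becomes `Δ i`.
  set P : PrefMatrix K := PrefMatrix.ofMargin (fun j k => Δ k - Δ j) (fun j k => by ring)
    (fun j k => by linarith [hn j, hle k]) with hPdef
  have hr0 : ∀ a, Δ (Equiv.swap a₀ a a) = 0 := fun a => by rw [Equiv.swap_apply_right, hΔ.1]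
  have hr : ∀ a k, |Δ (Equiv.swap a₀ a k)| ≤ 1 / 2 := fun a k => by
    rw [abs_of_nonneg (hn _)]
    linarith [hle (Equiv.swap a₀ a k)]
  set Q : Fin K → PrefMatrix K := fun a =>
    P.updateArm a (fun k => Δ (Equiv.swap a₀ a k)) (hr0 a) (hr a)
  have hgap : ∀ a k, gap (Q a) a k = Δ (Equiv.swap a₀ a k) := fun a k =>
    gap_updateArm _ _ _ _ _ _
  refine ⟨Q, fun a => ⟨fun k => ?_, Equiv.swap a₀ a, hgap a⟩, ?_⟩
  · have h1 := hgap a k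
    have h2 := hn (Equiv.swap a₀ a k)
    rw [gap] at h1
    linarith
  have hprom : ∀ i, IsPromotion P (Q i) i (2 * Δ i) := fun i => by
    refine isPromotion_updateArm _ _ _ _ _ (fun k => ⟨hn _, hle _⟩) fun k => ?_
    change |1 / 2 + (Δ k - Δ i) - (1 / 2 + Δ (Equiv.swap a₀ i k))| ≤ _
    have h0 := hn i
    rcases eq_or_ne k a₀ with rfl | hk
    · rw [Equiv.swap_apply_left, hΔ.1, abs_le]
      constructor <;> linarith
    rcases eq_or_ne k i with rfl | hk'
    · rw [Equiv.swap_apply_right, hΔ.1, abs_le]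
      constructor <;> linarith
    · rw [Equiv.swap_apply_of_ne_of_ne hk hk', abs_le]
      constructor <;> linarith
  -- For `i = a₀` the divisor `100 * Δ i ^ 2` is `0`, which is harmless since the estimate holds for
  -- every `C`.
  have hev : ∀ᶠ T : ℕ in atTop, ∀ i, _ :=
    eventually_all.2 fun i : Fin K => eventually_log_add_rpow_le
      (1 / 100 * ∑ i ∈ Finset.univ.erase a₀, 1 / Δ i) 0 hg0 (100 * Δ i ^ 2)
  filter_upwards [hev, eventually_gt_atTop 0] with T hT hT0 alg
  -- The base belongs to the family, so both outcomes of the dichotomy below name a member of it.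
  have hbase : Q a₀ = P := by
    refine PrefMatrix.ext_prob fun j k => ?_
    simp only [Q, hPdef, PrefMatrix.updateArm, PrefMatrix.ofMargin, Equiv.swap_self,
      Equiv.refl_apply]
    split_ifs with hj hk
    · rw [hj, hΔ.1, sub_zero]
    · rw [hk, hΔ.1]
      ring
    · rfl
  have hsum : ∀ a, logGapSum (Q a) a T = _ := fun a =>
    logGapSum_eq_of_perm (Equiv.swap a₀ a) (hgap a) (Equiv.swap_apply_right a₀ a) T
  by_cases hN : ∀ i, i ≠ a₀ →
      Real.log T / (100 * gap (Q a₀) a₀ i ^ 2) ≤ histExp hm (Q a₀) (alg T) T (playCount i)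
  · refine ⟨a₀, logGapSum_le_expectedRegret hm (fun i hi => ?_) alg T hN⟩
    rw [hgap, Equiv.swap_self]
    exact (hΔ.2 i hi).1
  · push Not at hN
    obtain ⟨i, hi, hlt⟩ := hN
    rw [hgap, Equiv.swap_self, Equiv.refl_apply, hbase] at hlt
    refine ⟨i, ?_⟩
    refine le_trans ?_ ((hprom i).le_expectedRegret hm (hΔ.2 i hi).1 hg0.le (fun k hk => ?_)
      alg hT0 hlt.le)
    · have := hT i
      rw [hsum]
      linarith
    · rw [hgap]
      refine hg _ fun h => hk ?_
      exact (Equiv.swap a₀ i).injective (h.trans (Equiv.swap_apply_right a₀ i).symm)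

/-- An instance with prescribed gaps on which every consistent algorithm has large regret. -/
theorem exists_hard_instance (hm : 2 ≤ m) {Δ : Fin K → ℝ} {a : Fin K}
    (hΔ : IsGapVector Δ a (1 / 2)) :
    ∃ P : PrefMatrix K, IsCondorcetWinner P a ∧ (∀ i, gap P a i = Δ i) ∧
      ∀ alg : Algorithm K m, Consistent hm alg →
        ∀ᶠ T : ℕ in atTop, 1 / 100 * logGapSum P a T ≤ expectedRegret hm P a alg T := by
  have hn := hΔ.nonneg
  have hle := hΔ.le (by norm_num)
  -- All arms other than `a` tie with each other, so promoting any of them needs only a small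
  -- change.
  set P : PrefMatrix K := (PrefMatrix.ofMargin (fun _ _ => 0) (fun _ _ => by norm_num)
    (fun _ _ => by norm_num)).updateArm a Δ hΔ.1
      (fun k => by rw [abs_of_nonneg (hn k)]; exact hle k) with hPdef
  have hgap : ∀ k, gap P a k = Δ k := gap_updateArm _ _ _ _ _
  refine ⟨P, fun k => ?_, hgap, fun alg halg => ?_⟩
  · have h1 := hgap k
    have h2 := hn k
    rw [gap] at h1
    linarith
  have key : ∀ i, ∀ᶠ T : ℕ in atTop, i ≠ a →
      Real.log T / (100 * gap P a i ^ 2) ≤ histExp hm P (alg T) T (playCount i) := by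
    intro i
    by_cases hi : i = a
    · exact Eventually.of_forall fun T h => absurd hi h
    have h0 := (hΔ.2 i hi).1
    have hr' : ∀ k, 0 ≤ (if k = i then 0 else Δ i / 2) ∧
        (if k = i then 0 else Δ i / 2) ≤ 1 / 4 := fun k => by
      have := hle i
      split_ifs <;> constructor <;> linarith
    -- The margin `Δ i / 2` is at most `1 / 4`, as a promotion requires; against `a` the change is
    -- `3 Δ i / 2 ≤ 2 Δ i`.
    set P' : PrefMatrix K := P.updateArm i (fun k => if k = i then 0 else Δ i / 2) (if_pos rfl)
      (fun k => by rw [abs_of_nonneg (hr' k).1]; linarith [(hr' k).2])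
    have hgap' : ∀ k, gap P' i k = if k = i then 0 else Δ i / 2 := gap_updateArm _ _ _ _ _
    have hprom : IsPromotion P P' i (2 * Δ i) := by
      refine isPromotion_updateArm _ _ _ _ _ hr' fun k => ?_
      have hPik : P.prob i k = if k = a then 1 / 2 - Δ i else 1 / 2 := by
        simp [hPdef, PrefMatrix.updateArm, PrefMatrix.ofMargin, hi]
      rw [hPik, abs_le]
      split_ifs <;> constructor <;> linarith
    have hwin : IsCondorcetWinner P' i := fun k => by
      have h1 := hgap' k
      have h2 := (hr' k).1
      rw [gap] at h1
      linarith
    have hpos : ∀ k, k ≠ i → gap P' i k = Δ i / 2 := fun k hk => by rw [hgap', if_neg hk]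
    -- Any exponent below `1 / 2` would contradict regret of order `√T`.
    have hcons := (halg P' i hwin (fun k hk => by rw [hpos k hk]; linarith) (1 / 4)
      (by norm_num)).def one_pos
    filter_upwards [hcons, eventually_gt_atTop 0, eventually_log_add_rpow_le 0 1
      (show 0 < Δ i / 2 by linarith) (100 * Δ i ^ 2)] with T hT hT0 hbig _
    by_contra! hlt
    rw [hgap] at hlt
    have h1 := hprom.le_expectedRegret hm h0 (show 0 ≤ Δ i / 2 by linarith)
      (fun k hk => (hpos k hk).ge) alg hT0 hlt.le
    have h2 : (0 : ℝ) ≤ (T : ℝ) ^ (1 / 4 : ℝ) := by positivity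
    rw [Real.norm_eq_abs, Real.norm_eq_abs, abs_of_nonneg h2] at hT
    have h3 := (le_abs_self _).trans hT
    linarith
  filter_upwards [eventually_all.2 key] with T hT
  exact logGapSum_le_expectedRegret hm (fun i hi => by rw [hgap]; exact (hΔ.2 i hi).1) alg T hT

end MultiDueling

end

theorem theorem4 :
    ∃ c : ℝ, 0 < c ∧ ∀ (K m : ℕ) (hm : 2 ≤ m), m ≤ K →
      -- every algorithm, gaps prescribed up to a relabelling of the arms
      (∀ (Δ : Fin K → ℝ) (a₀ : Fin K), MultiDueling.IsGapVector Δ a₀ (1 / 4) →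
        (∃ T₀ : ℕ, ∀ T : ℕ, T₀ ≤ T → ∀ alg : MultiDueling.Algorithm K m,
          ∃ (P : MultiDueling.PrefMatrix K) (a : Fin K),
            MultiDueling.IsCondorcetWinner P a ∧
            (∃ σ : Equiv.Perm (Fin K), ∀ i, MultiDueling.gap P a i = Δ (σ i)) ∧
            c * MultiDueling.logGapSum P a T ≤ MultiDueling.expectedRegret hm P a alg T) ∧
        (∀ alg : MultiDueling.Algorithm K m,
          ∃ (P : MultiDueling.PrefMatrix K) (a : Fin K),
            MultiDueling.IsCondorcetWinner P a ∧
            (∃ σ : Equiv.Perm (Fin K), ∀ i, MultiDueling.gap P a i = Δ (σ i)) ∧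
            ∃ᶠ T : ℕ in Filter.atTop,
              c * MultiDueling.logGapSum P a T ≤ MultiDueling.expectedRegret hm P a alg T)) ∧
      -- every consistent algorithm, gaps prescribed exactly
      (∀ (Δ : Fin K → ℝ) (a : Fin K), MultiDueling.IsGapVector Δ a (1 / 2) →
        ∃ P : MultiDueling.PrefMatrix K,
          MultiDueling.IsCondorcetWinner P a ∧
          (∀ i, MultiDueling.gap P a i = Δ i) ∧
          ∀ alg : MultiDueling.Algorithm K m, MultiDueling.Consistent hm alg →
            ∀ᶠ T : ℕ in Filter.atTop,
              c * MultiDueling.logGapSum P a T ≤ MultiDueling.expectedRegret hm P a alg T) := by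
  refine ⟨1 / 100, by norm_num, fun K m hm _ => ⟨fun Δ a₀ hΔ => ?_, fun Δ a hΔ =>
    MultiDueling.exists_hard_instance hm hΔ⟩⟩
  obtain ⟨Q, hQ, hev⟩ := MultiDueling.exists_hard_family hm hΔ
  constructor
  · obtain ⟨T₀, hT₀⟩ := eventually_atTop.1 hev
    refine ⟨T₀, fun T hT alg => ?_⟩
    obtain ⟨a, ha⟩ := hT₀ T hT alg
    exact ⟨Q a, a, (hQ a).1, (hQ a).2, ha⟩
  · intro alg
    -- Pigeonhole: the hard member may vary with `T`, but the family is finite and independent of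
    -- `T`, so one member recurs infinitely often.
    obtain ⟨a, ha⟩ := frequently_exists.1 (hev.mono fun T hT => hT alg).frequently
    exact ⟨Q a, a, (hQ a).1, (hQ a).2, ha⟩
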